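/- Setting. Fix $d,m,C\in\mathbb N$. A graph dataset $\mathcal G=(\mathbf A,\mathbf X,\mathbf Y)$ on $N$ nodes consists of a binary adjacency matrix $\mathbf A\in\{0,1\}^{N\times N}$ of a directed graph ($\mathbf A_{u,v}=1$ iff there is an edge $u\to v$), feature vectors $\mathbf X_v\in\mathbb R^d$ and labels $\mathbf Y_v\in\{0,1\}^C$ (one-hot, or zero if $v$ is unlabeled). Two graph datasets are node-level adjacent if one is obtained from the other by removing a single node together with its features, its label and all attached edges; two tables with one row per node are adjacent if one is obtained from the other by removing a single row. A randomized algorithm $\mathcal A$ is $(\alpha,\epsilon)$-RDP if $D_\alpha(\mathcal A(x)\Vert\mathcal A(x'))\le\epsilon$ for all adjacent $x,x'$, where $D_\alpha(P\Vert Q)=\frac1{\alpha-1}\log\mathbb E_{z\sim Q}\big[(P(z)/Q(z))^\alpha\big]$ (and $D_\alpha(P\Vert Q)=\infty$ if $P\not\ll Q$); it is $(\epsilon,\delta)$-DP if $\Pr[\mathcal A(x)\in S]\le e^\epsilon\Pr[\mathcal A(x')\in S]+\delta$ for all adjacent $x,x'$ and all measurable $S$. GAP training. Let $K\ge1$ and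 $\sigma>0$, and let $x\mapsto\mathrm{enc}(x;\theta)\in\mathbb R^m$ be an encoder with parameters $\theta$, acting on each node's features separately (measurably in $\theta$). On input $\mathcal G$, GAP training proceeds as follows. 1. Encoder pre-training: a randomized algorithm with input the table of rows $(\mathbf X_v,\mathbf Y_v)$ outputs $\theta$. 2. Encode: $\mathbf X^{(0)}_v=\mathrm{enc}(\mathbf X_v;\theta)$ for every node $v$. 3. Normalize: $\check{\mathbf X}^{(0)}_v=\mathbf X^{(0)}_v/\Vert\mathbf X^{(0)}_v\Vert_2$ for every node $v$ (with $0/0=0$). 4. Private multi-hop aggregation: for $k=1,\dots,K$, put $\mathbf X^{(k)}=\mathbf A^{T}\check{\mathbf X}^{(k-1)}$, $\widetilde{\mathbf X}^{(k)}_v=\mathbf X^{(k)}_v+\mathcal N(0,\sigma^2\mathbb I_m)$ with fresh independent noise for every node $v$ and every $k$, and $\check{\mathbf X}^{(k)}_v=\widetilde{\mathbf X}^{(k)}_v/\Vert\widetilde{\mathbf X}^{(k)}_v\Vert_2$ (with $0/0=0$). 5. Classification-module training: a randomized algorithm with input the table of rows $(\check{\mathbf X}^{(0)}_v,\dots,\check{\mathbf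 X}^{(K)}_v,\mathbf Y_v)$ outputs the classification-module parameters $\theta'$. The output is $(\theta,\theta')$; both parameters take values in standard Borel spaces (for instance Euclidean spaces). Proposition. Let $\alpha>1$. Suppose that encoder pre-training (step 1) is $(\alpha,\epsilon_1(\alpha))$-RDP, as an algorithm on tables of feature vectors and labels, and that classification-module training (step 5) is $(\alpha,\epsilon_5(\alpha))$-RDP, as an algorithm on tables of $(K+1)$-tuples of normalized vectors (unit or zero) and labels. Then for every $\delta\in(0,1)$, $K\ge1$, $D\ge1$ and $\sigma>0$, GAP training on graph datasets in which every node has at most $D$ outgoing edges is node-level $(\epsilon,\delta)$-DP with $$\epsilon=\epsilon_1(\alpha)+\epsilon_5(\alpha)+\frac{DK\alpha}{2\sigma^2}+\frac{\log(1/\delta)}{\alpha-1}.$$ -/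

import Mathlib

open MeasureTheory ProbabilityTheory
open scoped ENNReal

namespace GAP

/-! ### Rényi divergence, Rényi differential privacy, differential privacy -/

/-- The Rényi divergence `D_α(P ‖ Q) = (α - 1)⁻¹ * log E_{x ∼ Q} [(P(x) / Q(x)) ^ α]` of order
`α > 1`, where `P / Q` is the density of `P` with respect to `Q`; as usual it is `∞` if `P` is not
absolutely continuous with respect to `Q`. -/
noncomputable def renyiDiv {Ω : Type*} [MeasurableSpace Ω] (α : ℝ) (P Q : Measure Ω) : EReal :=
  open Classical in
  if P ≪ Q then
    (((α - 1)⁻¹ : ℝ) : EReal) * ENNReal.log (∫⁻ x, (P.rnDeriv Q x) ^ α ∂Q)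
  else ⊤

/-- A randomized algorithm `M` on datasets `𝒟` is `(α, ε)`-RDP for the adjacency relation `adj`. -/
def IsRDP {𝒟 Ω : Type*} [MeasurableSpace Ω] (adj : 𝒟 → 𝒟 → Prop) (M : 𝒟 → Measure Ω)
    (α ε : ℝ) : Prop :=
  ∀ x x' : 𝒟, adj x x' → renyiDiv α (M x) (M x') ≤ (ε : EReal)

/-- A randomized algorithm `M` on datasets `𝒟` is `(ε, δ)`-DP for the adjacency relation `adj`. -/
def IsDP {𝒟 Ω : Type*} [MeasurableSpace Ω] (adj : 𝒟 → 𝒟 → Prop) (M : 𝒟 → Measure Ω)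
    (ε δ : ℝ) : Prop :=
  ∀ x x' : 𝒟, adj x x' → ∀ S : Set Ω, MeasurableSet S →
    M x S ≤ ENNReal.ofReal (Real.exp ε) * M x' S + ENNReal.ofReal δ

/-! ### Labels, tables of nodes, graph datasets -/

/-- Labels for `C` classes: `some c` stands for the one-hot vector of the class `c`, and `none` for
the zero vector, i.e. for an unlabeled node. -/
abbrev Label (C : ℕ) : Type := Option (Fin C)

instance instMeasurableSpaceLabel (C : ℕ) : MeasurableSpace (Label C) := ⊤

/-- Tables with any number `n` of rows, one for each node, a row consisting of features in `F` and
a label. -/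
abbrev NodeTable (F : Type*) (C : ℕ) := Σ n : ℕ, (Fin n → F) × (Fin n → Label C)

/-- Two tables are adjacent if one is obtained from the other by removing a single row. -/
def TableAdj {F : Type*} {C : ℕ} (T T' : NodeTable F C) : Prop :=
  ∃ (n : ℕ) (X : Fin (n + 1) → F) (Y : Fin (n + 1) → Label C) (q : Fin (n + 1)),
    let full : NodeTable F C := ⟨n + 1, X, Y⟩
    let removed : NodeTable F C := ⟨n, fun v => X (q.succAbove v), fun v => Y (q.succAbove v)⟩
    (T = full ∧ T' = removed) ∨ (T = removed ∧ T' = full)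

/-- A directed graph dataset on `n` nodes: the adjacency matrix (`A i j = true` iff there is an edge
from `i` to `j`), `d`-dimensional node features, and node labels. -/
structure GraphData (d C n : ℕ) where
  /-- adjacency matrix -/
  A : Matrix (Fin n) (Fin n) Bool
  /-- node features -/
  X : Fin n → EuclideanSpace ℝ (Fin d)
  /-- node labels -/
  Y : Fin n → Label C

/-- Graph datasets with any number of nodes. -/
abbrev GraphDataset (d C : ℕ) := Σ n : ℕ, GraphData d C n

/-- Remove the node `q` with its features, its label and all attached edges. -/
def GraphData.removeNode {d C n : ℕ} (G : GraphData d C (n + 1)) (q : Fin (n + 1)) :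
    GraphData d C n where
  A := G.A.submatrix q.succAbove q.succAbove
  X := fun v => G.X (q.succAbove v)
  Y := fun v => G.Y (q.succAbove v)

/-- Every node has at most `D` outgoing edges. -/
def DegreeBounded {d C : ℕ} (D : ℕ) (G : GraphDataset d C) : Prop :=
  ∀ u : Fin G.1, (Finset.univ.filter (fun v => G.2.A u v = true)).card ≤ D

/-- Node-level adjacency: one graph dataset is obtained from the other by removing a node. -/
def NodeAdj {d C : ℕ} (G G' : GraphDataset d C) : Prop :=
  ∃ (n : ℕ) (H : GraphData d C (n + 1)) (q : Fin (n + 1)),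
    (G = ⟨n + 1, H⟩ ∧ G' = ⟨n, H.removeNode q⟩) ∨ (G = ⟨n, H.removeNode q⟩ ∧ G' = ⟨n + 1, H⟩)

/-- Node-level adjacency among the graph datasets whose degrees are bounded by `D`. -/
def BoundedNodeAdj {d C : ℕ} (D : ℕ) (G G' : GraphDataset d C) : Prop :=
  NodeAdj G G' ∧ DegreeBounded D G ∧ DegreeBounded D G'

/-- The features and labels of the nodes, without the edges. -/
def nodeTable {d C : ℕ} (G : GraphDataset d C) : NodeTable (EuclideanSpace ℝ (Fin d)) C :=
  ⟨G.1, G.2.X, G.2.Y⟩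

/-! ### Private multi-hop aggregation -/

/-- Normalized vectors: the unit vectors, together with `0`, which `x ↦ x / ‖x‖` sends to `0`. -/
abbrev NVec (m : ℕ) := {x : EuclideanSpace ℝ (Fin m) // ‖x‖ = 1 ∨ x = 0}

/-- Normalization `x ↦ x / ‖x‖`, with the convention `0 / 0 = 0`. -/
noncomputable def normalize {m : ℕ} (x : EuclideanSpace ℝ (Fin m)) : NVec m :=
  ⟨‖x‖⁻¹ • x, by
    rcases eq_or_ne x 0 with h | h
    · right; simp [h]
    · left; rw [norm_smul, norm_inv, norm_norm, inv_mul_cancel₀ (norm_ne_zero_iff.mpr h)]⟩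

lemma measurable_normalize {m : ℕ} : Measurable (normalize (m := m)) :=
  (measurable_norm.inv.smul measurable_id).subtype_mk

/-- Sum aggregation `Aᵀ X`: the row of `v` is the sum of the rows of the `u` with an edge `u → v`. -/
noncomputable def aggregate {m n : ℕ} (A : Matrix (Fin n) (Fin n) Bool) (X : Fin n → NVec m) :
    Fin n → EuclideanSpace ℝ (Fin m) :=
  fun v => ∑ u, (if A u v then (1 : ℝ) else 0) • (X u : EuclideanSpace ℝ (Fin m))

lemma measurable_aggregate {m n : ℕ} (A : Matrix (Fin n) (Fin n) Bool) :
    Measurable (aggregate (m := m) A) := by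
  unfold aggregate
  fun_prop

/-- The isotropic Gaussian law `N(0, σ² I)` on `ℝᵐ`. -/
noncomputable def gaussianNoise (m : ℕ) (σ : ℝ) : Measure (EuclideanSpace ℝ (Fin m)) :=
  (Measure.pi fun _ : Fin m => gaussianReal 0 (Real.toNNReal (σ ^ 2))).map (WithLp.toLp 2)

instance instProbNoise (m : ℕ) (σ : ℝ) : IsProbabilityMeasure (gaussianNoise m σ) :=
  Measure.isProbabilityMeasure_map (by fun_prop)

lemma measurable_perturb {m n : ℕ} (A : Matrix (Fin n) (Fin n) Bool) :
    Measurable (fun p : (Fin n → NVec m) × (Fin n → EuclideanSpace ℝ (Fin m)) =>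
      fun v => normalize (aggregate A p.1 v + p.2 v)) := by
  have h := measurable_aggregate (m := m) A
  refine measurable_pi_lambda _ fun v => measurable_normalize.comp ?_
  exact ((measurable_pi_apply v).comp (h.comp measurable_fst)).add
    ((measurable_pi_apply v).comp measurable_snd)

/-- One hop: aggregate, add independent `N(0, σ² I)` noise to every row, normalize every row. -/
noncomputable def hop {n : ℕ} (m : ℕ) (σ : ℝ) (A : Matrix (Fin n) (Fin n) Bool) :
    Kernel (Fin n → NVec m) (Fin n → NVec m) :=
  (Kernel.id ×ₖ Kernel.const _ (Measure.pi fun _ : Fin n => gaussianNoise m σ)).map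
    (fun p v => normalize (aggregate A p.1 v + p.2 v))

instance instMarkovHop {n : ℕ} (m : ℕ) (σ : ℝ) (A : Matrix (Fin n) (Fin n) Bool) :
    IsMarkovKernel (hop m σ A) :=
  Kernel.IsMarkovKernel.map _ (measurable_perturb A)

/-- Private multi-hop aggregation with `K` hops: from the initial normalized features, the joint law
of the features of the hops `0, …, K`, where hop `0` consists of the initial features and each hop
`k + 1` is sampled from hop `k`. -/
noncomputable def pma {n : ℕ} (m : ℕ) (σ : ℝ) (A : Matrix (Fin n) (Fin n) Bool) :
    (K : ℕ) → Kernel (Fin n → NVec m) (Fin (K + 1) → Fin n → NVec m)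
  | 0 => Kernel.deterministic (fun X _ => X) (by fun_prop)
  | K + 1 =>
    (pma m σ A K ⊗ₖ (hop m σ A).comap
      (fun p : (Fin n → NVec m) × (Fin (K + 1) → Fin n → NVec m) => p.2 (Fin.last K))
      (by fun_prop)).map
    (fun p => Fin.snoc (α := fun _ => Fin n → NVec m) p.1 p.2)

lemma measurable_snoc {K : ℕ} {E : Type*} [MeasurableSpace E] :
    Measurable (fun p : (Fin (K + 1) → E) × E => Fin.snoc (α := fun _ => E) p.1 p.2) := by
  refine measurable_pi_lambda _ fun i => ?_
  refine Fin.lastCases ?_ (fun j => ?_) i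
  · simpa using measurable_snd
  · simp only [Fin.snoc_castSucc]
    exact (measurable_pi_apply j).comp measurable_fst

instance instMarkovPma {n : ℕ} (m : ℕ) (σ : ℝ) (A : Matrix (Fin n) (Fin n) Bool) (K : ℕ) :
    IsMarkovKernel (pma m σ A K) := by
  induction K with
  | zero => unfold pma; infer_instance
  | succ K ih => unfold pma; exact Kernel.IsMarkovKernel.map _ measurable_snoc

/-! ### Training -/

/-- The table handed to classification-module training: the row of `v` holds the features of `v` at
the hops `0, …, K`, and the label of `v`. -/
def hopTable {m n C K : ℕ} (Y : Fin n → Label C) (X : Fin (K + 1) → Fin n → NVec m) :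
    NodeTable (Fin (K + 1) → NVec m) C :=
  ⟨n, fun v k => X k v, Y⟩

lemma measurable_hopTable {m n C K : ℕ} (Y : Fin n → Label C) :
    Measurable (hopTable (m := m) (K := K) Y) := by
  have h : Measurable (fun X : Fin (K + 1) → Fin n → NVec m =>
      ((fun v k => X k v, Y) : (Fin n → Fin (K + 1) → NVec m) × (Fin n → Label C))) := by
    fun_prop
  have h' : Measurable (Sigma.mk n : _ → NodeTable (Fin (K + 1) → NVec m) C) :=
    Measurable.of_le_map (iInf_le _ n)
  exact h'.comp h

/-- The encoder is applied to every row of `X`, and the result is normalized. -/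
noncomputable def encodeNormalize {d m n : ℕ} {Θenc : Type*}
    (enc : Θenc → EuclideanSpace ℝ (Fin d) → EuclideanSpace ℝ (Fin m))
    (X : Fin n → EuclideanSpace ℝ (Fin d)) (θ : Θenc) : Fin n → NVec m :=
  fun v => normalize (enc θ (X v))

lemma measurable_encodeNormalize {d m n : ℕ} {Θenc : Type*} [MeasurableSpace Θenc]
    {enc : Θenc → EuclideanSpace ℝ (Fin d) → EuclideanSpace ℝ (Fin m)}
    (henc : ∀ x, Measurable fun θ => enc θ x) (X : Fin n → EuclideanSpace ℝ (Fin d)) :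
    Measurable (encodeNormalize enc X) :=
  measurable_pi_lambda _ fun v => measurable_normalize.comp (henc (X v))

/-- GAP training: pre-train the encoder on the node features and labels; encode and normalize the
features; run private multi-hop aggregation with `K` hops and noise variance `σ ^ 2`; train the
classification module on the resulting features and on the labels. The result is the joint law of
the encoder parameters and of the classification-module parameters. -/
noncomputable def gapTraining {d C m K : ℕ} {Θenc Θcm : Type*} [MeasurableSpace Θenc]
    [MeasurableSpace Θcm]
    (enc : Θenc → EuclideanSpace ℝ (Fin d) → EuclideanSpace ℝ (Fin m))
    (henc : ∀ x, Measurable fun θ => enc θ x)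
    (trainEnc : NodeTable (EuclideanSpace ℝ (Fin d)) C → Measure Θenc)
    (trainCM : Kernel (NodeTable (Fin (K + 1) → NVec m) C) Θcm)
    (σ : ℝ) (G : GraphDataset d C) : Measure (Θenc × Θcm) :=
  (trainEnc (nodeTable G)) ⊗ₘ
    (trainCM.comap (hopTable G.2.Y) (measurable_hopTable G.2.Y) ∘ₖ
      ((pma m σ G.2.A K).comap (encodeNormalize enc G.2.X)
        (measurable_encodeNormalize henc G.2.X)))

end GAP

/-!
GAP training is an adaptive composition of the encoder pre-training, of `K` noisy hops, and of the
classification-module training, so Rényi bounds for these pieces add up, and the standard conversion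
turns the total into an `(ε, δ)`-bound.

Rényi bounds are used in a dual form, `HolderDom`, which bounds `∫ φ dP` in terms of `∫ φ ^ β dQ` with
`β = α / (α - 1)` for all measurable `φ ≥ 0`. It follows from a bound on the Rényi divergence by
Hölder's inequality (`HolderDom.of_renyiDiv`). In this form data processing is a change of variables,
adaptive composition is two applications of the hypothesis under an iterated integral
(`HolderDom.compProd`), with no need for densities of kernels, and the conversion to differential
privacy is the case of an indicator function (`HolderDom.apply_le`).

The hops on the graph with the node `q` removed produce no features for `q`, whereas those on the
full graph do, and feed them into later hops. The remedy is to simulate them: on all `n + 1` nodes,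
run the aggregation along the graph `dropOut A q`, in which only the edges from `q` to other nodes are
deleted. The row of `q` then has the same conditional law, given the previous hop, as in the full
graph, and it never influences the other rows, so these are distributed as on the smaller graph
(`pma_dropOut_map`). One hop along `A` and one along `dropOut A q` are products of Gaussian laws whose
means differ, by a vector of norm at most `1`, at the at most `D` out-neighbors of `q` only; hence
their divergence is at most `D α / (2 σ²)` (`holderDom_hop`). Finally, for each fixed path of hop
features, the two tables handed to the classification-module training differ by the row of `q`.
-/

namespace GAP

/-! ### The dual form of a Rényi bound -/

/-- `HolderDom β ε P Q` says that `∫ φ dP ≤ (exp ε * ∫ φ ^ β dQ) ^ (1 / β)` for every measurable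
`φ ≥ 0`. For the exponent `β = α / (α - 1)` conjugate to `α` this is the dual form of
`D_α(P ‖ Q) ≤ ε`: it bounds the norm in `L^α(Q)` of the density `dP / dQ` by testing it against
`L^β(Q)`, without mentioning the density. -/
def HolderDom {Ω : Type*} [MeasurableSpace Ω] (β ε : ℝ) (P Q : Measure Ω) : Prop :=
  ∀ φ : Ω → ℝ≥0∞, Measurable φ →
    ∫⁻ x, φ x ∂P ≤ (ENNReal.ofReal (Real.exp ε) * ∫⁻ x, φ x ^ β ∂Q) ^ (1 / β)

section HolderDom

variable {Ω Ω' : Type*} [MeasurableSpace Ω] [MeasurableSpace Ω'] {α β ε ε' : ℝ}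
  {P Q : Measure Ω}

lemma HolderDom.mono (hβ : 0 < β) (h : HolderDom β ε P Q) (hε : ε ≤ ε') : HolderDom β ε' P Q := by
  intro φ hφ
  refine (h φ hφ).trans ?_
  have h' : 0 ≤ 1 / β := by positivity
  gcongr

/-- Data processing. -/
lemma HolderDom.map (h : HolderDom β ε P Q) {f : Ω → Ω'} (hf : Measurable f) :
    HolderDom β ε (P.map f) (Q.map f) := by
  intro φ hφ
  rw [lintegral_map hφ hf, lintegral_map (hφ.pow_const β) hf]
  exact h _ (hφ.comp hf)

/-- Adaptive composition. -/
lemma HolderDom.compProd [SFinite P] [SFinite Q] {κ η : Kernel Ω Ω'} [IsSFiniteKernel κ]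
    [IsSFiniteKernel η] (hβ : 0 < β) (h : HolderDom β ε P Q)
    (h' : ∀ x, HolderDom β ε' (κ x) (η x)) :
    HolderDom β (ε + ε') (P ⊗ₘ κ) (Q ⊗ₘ η) := by
  intro φ hφ
  rw [Measure.lintegral_compProd hφ, Measure.lintegral_compProd (hφ.pow_const β)]
  have hm : Measurable fun x => ∫⁻ y, φ (x, y) ^ β ∂(η x) :=
    (hφ.pow_const β).lintegral_kernel_prod_right'
  calc ∫⁻ x, ∫⁻ y, φ (x, y) ∂(κ x) ∂P
      ≤ ∫⁻ x, (ENNReal.ofReal (Real.exp ε') * ∫⁻ y, φ (x, y) ^ β ∂(η x)) ^ (1 / β) ∂P :=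
        lintegral_mono fun x => h' x (fun y => φ (x, y)) (by fun_prop)
    _ ≤ (ENNReal.ofReal (Real.exp ε) * ∫⁻ x, ((ENNReal.ofReal (Real.exp ε') *
          ∫⁻ y, φ (x, y) ^ β ∂(η x)) ^ (1 / β)) ^ β ∂Q) ^ (1 / β) :=
        h _ ((hm.const_mul _).pow_const _)
    _ = _ := by
        simp_rw [one_div, ENNReal.rpow_inv_rpow hβ.ne']
        rw [lintegral_const_mul _ hm, ← mul_assoc, ← ENNReal.ofReal_mul (Real.exp_nonneg _),
          ← Real.exp_add]

lemma HolderDom.bind [SFinite P] [SFinite Q] {κ η : Kernel Ω Ω'} [IsSFiniteKernel κ]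
    [IsSFiniteKernel η] (hβ : 0 < β) (h : HolderDom β ε P Q)
    (h' : ∀ x, HolderDom β ε' (κ x) (η x)) :
    HolderDom β (ε + ε') (P.bind κ) (Q.bind η) := by
  rw [← Measure.snd_compProd, ← Measure.snd_compProd]
  exact (h.compProd hβ h').map measurable_snd

lemma HolderDom.prod {P' Q' : Measure Ω'} [SFinite P] [SFinite Q] [SFinite P'] [SFinite Q']
    (hβ : 0 < β) (h : HolderDom β ε P Q) (h' : HolderDom β ε' P' Q') :
    HolderDom β (ε + ε') (P.prod P') (Q.prod Q') := by
  rw [← Measure.compProd_const, ← Measure.compProd_const]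
  exact h.compProd hβ fun _ => by simpa using h'

lemma HolderDom.pi (hβ : 0 < β) {n : ℕ} {ε : Fin n → ℝ} {P Q : Fin n → Measure Ω}
    [∀ i, IsProbabilityMeasure (P i)] [∀ i, IsProbabilityMeasure (Q i)]
    (h : ∀ i, HolderDom β (ε i) (P i) (Q i)) :
    HolderDom β (∑ i, ε i) (Measure.pi P) (Measure.pi Q) := by
  induction n with
  | zero =>
    intro φ _
    rw [Measure.pi_of_empty, Measure.pi_of_empty]
    simp [ENNReal.rpow_rpow_inv hβ.ne']
  | succ n ih =>
    rw [← (measurePreserving_piFinSuccAbove P 0).symm.map_eq,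
      ← (measurePreserving_piFinSuccAbove Q 0).symm.map_eq, Fin.sum_univ_succAbove _ 0]
    exact ((h 0).prod hβ (ih fun i => h _)).map (MeasurableEquiv.measurable _)

/-- Hölder's inequality: a bound on the moment of order `α` of a density yields `HolderDom`. -/
lemma HolderDom.of_density (hα : 1 < α) {h : Ω → ℝ≥0∞} (hm : Measurable h)
    (hP : P = Q.withDensity h)
    (hb : ∫⁻ x, h x ^ α ∂Q ≤ ENNReal.ofReal (Real.exp ((α - 1) * ε))) :
    HolderDom (α / (α - 1)) ε P Q := by
  intro φ hφ
  have hα0 : 0 < α := by linarith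
  have hα1 : 0 < α - 1 := by linarith
  have hc : α.HolderConjugate (α / (α - 1)) := Real.HolderConjugate.conjExponent hα
  rw [hP, lintegral_withDensity_eq_lintegral_mul _ hm hφ]
  refine (ENNReal.lintegral_mul_le_Lp_mul_Lq Q hc hm.aemeasurable hφ.aemeasurable).trans ?_
  rw [ENNReal.mul_rpow_of_nonneg _ _ (by positivity)]
  gcongr
  calc (∫⁻ x, h x ^ α ∂Q) ^ (1 / α)
      ≤ ENNReal.ofReal (Real.exp ((α - 1) * ε)) ^ (1 / α) := by gcongr
    _ = _ := by
        rw [ENNReal.ofReal_rpow_of_pos (Real.exp_pos _), ENNReal.ofReal_rpow_of_pos (Real.exp_pos _),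
          ← Real.exp_mul, ← Real.exp_mul]
        congr 2
        field_simp

lemma HolderDom.of_renyiDiv [SigmaFinite P] [SigmaFinite Q] (hα : 1 < α)
    (h : renyiDiv α P Q ≤ (ε : EReal)) : HolderDom (α / (α - 1)) ε P Q := by
  have hα1 : 0 < α - 1 := by linarith
  unfold renyiDiv at h
  split_ifs at h with hPQ
  · refine HolderDom.of_density hα (Measure.measurable_rnDeriv P Q)
      (Measure.withDensity_rnDeriv_eq P Q hPQ).symm ?_
    set I := ∫⁻ x, (P.rnDeriv Q x) ^ α ∂Q
    rw [← EReal.exp_coe, ← ENNReal.exp_log I, EReal.exp_le_exp_iff]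
    have h2 := mul_le_mul_of_nonneg_left h (a := ((α - 1 : ℝ) : EReal))
      (by exact_mod_cast hα1.le)
    rwa [← mul_assoc, ← EReal.coe_mul, mul_inv_cancel₀ hα1.ne', EReal.coe_one, one_mul,
      ← EReal.coe_mul] at h2
  · simp at h

/-- From Rényi to approximate differential privacy. -/
lemma HolderDom.apply_le (hα : 1 < α) (h : HolderDom (α / (α - 1)) ε P Q) {δ : ℝ} (hδ : 0 < δ)
    {S : Set Ω} (hS : MeasurableSet S) :
    P S ≤ ENNReal.ofReal (Real.exp (ε + Real.log (1 / δ) / (α - 1))) * Q S + ENNReal.ofReal δ := by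
  have hα0 : 0 < α := by linarith
  have hα1 : 0 < α - 1 := by linarith
  have hβ : 0 < α / (α - 1) := by positivity
  have key : P S ≤ (ENNReal.ofReal (Real.exp ε) * Q S) ^ (1 / (α / (α - 1))) := by
    have := h (S.indicator 1) (measurable_one.indicator hS)
    have e : ∀ x, (S.indicator (1 : Ω → ℝ≥0∞) x) ^ (α / (α - 1)) = S.indicator 1 x := by
      intro x
      by_cases hx : x ∈ S <;> simp [hx, hβ]
    simpa only [e, lintegral_indicator_one hS] using this
  refine key.trans ?_
  rw [Real.exp_add, ENNReal.ofReal_mul (Real.exp_nonneg _), mul_right_comm]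
  set x := ENNReal.ofReal (Real.exp ε) * Q S
  have hD : ENNReal.ofReal (Real.exp (Real.log (1 / δ) / (α - 1)))
      = ENNReal.ofReal δ ^ (-(1 / (α - 1))) := by
    rw [ENNReal.ofReal_rpow_of_pos hδ, Real.rpow_def_of_pos hδ, Real.log_div one_ne_zero hδ.ne',
      Real.log_one]
    congr 2
    ring
  have hδ' : ENNReal.ofReal δ ≠ 0 := by simpa using hδ
  -- The two terms of the bound are equal at `x = δ ^ (α / (α - 1))`.
  rcases le_or_gt x (ENNReal.ofReal δ ^ (α / (α - 1))) with hx | hx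
  · refine le_add_left ?_
    calc x ^ (1 / (α / (α - 1))) ≤ (ENNReal.ofReal δ ^ (α / (α - 1))) ^ (1 / (α / (α - 1))) := by
          gcongr
      _ = ENNReal.ofReal δ := by rw [one_div, ENNReal.rpow_rpow_inv hβ.ne']
  · refine le_add_right ?_
    rw [hD]
    rcases eq_or_ne x ⊤ with hxt | hxt
    · rw [hxt, ENNReal.top_mul]
      · exact le_top
      · exact (ENNReal.rpow_pos (pos_iff_ne_zero.mpr hδ') ENNReal.ofReal_ne_top).ne'
    have hx0 : x ≠ 0 := (pos_of_gt hx).ne'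
    calc x ^ (1 / (α / (α - 1))) = x * x ^ (-(1 / α)) := by
          nth_rw 2 [← ENNReal.rpow_one x]
          rw [← ENNReal.rpow_add _ _ hx0 hxt]
          congr 1
          field_simp
          ring
      _ ≤ x * (ENNReal.ofReal δ ^ (α / (α - 1))) ^ (-(1 / α)) := by
          rw [ENNReal.rpow_neg, ENNReal.rpow_neg]
          gcongr
      _ = x * ENNReal.ofReal δ ^ (-(1 / (α - 1))) := by
          rw [← ENNReal.rpow_mul]
          congr 2
          field_simp

end HolderDom

/-! ### Shifted Gaussian laws -/

section Gaussian

lemma gaussianReal_eq_withDensity (a b : ℝ) {v : NNReal} (hv : v ≠ 0) :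
    gaussianReal a v = (gaussianReal b v).withDensity
      (fun y => ENNReal.ofReal (Real.exp ((a - b) / v * y - (a ^ 2 - b ^ 2) / (2 * v)))) := by
  have hv' : (v : ℝ) ≠ 0 := by exact_mod_cast hv
  rw [gaussianReal_of_var_ne_zero _ hv, gaussianReal_of_var_ne_zero _ hv,
    ← withDensity_mul _ (measurable_gaussianPDF _ _) (by fun_prop)]
  congr 1
  ext y
  simp only [Pi.mul_apply, gaussianPDF]
  rw [← ENNReal.ofReal_mul (gaussianPDFReal_nonneg _ _ _)]
  simp only [gaussianPDFReal]
  rw [mul_assoc _ (Real.exp _) (Real.exp _), ← Real.exp_add]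
  congr 3
  field_simp
  ring

/-- The Rényi divergence of order `α` between `N(a, v)` and `N(b, v)` is `α (a - b)² / (2 v)`. -/
lemma holderDom_gaussianReal {α : ℝ} (hα : 1 < α) (a b : ℝ) {v : NNReal} (hv : v ≠ 0) :
    HolderDom (α / (α - 1)) (α * (a - b) ^ 2 / (2 * v)) (gaussianReal a v)
      (gaussianReal b v) := by
  have hv' : (v : ℝ) ≠ 0 := by exact_mod_cast hv
  refine HolderDom.of_density hα (by fun_prop) (gaussianReal_eq_withDensity a b hv) (le_of_eq ?_)
  have e : ∀ y : ℝ, ENNReal.ofReal (Real.exp ((a - b) / v * y - (a ^ 2 - b ^ 2) / (2 * v))) ^ α =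
      ENNReal.ofReal (Real.exp (-(α * (a ^ 2 - b ^ 2) / (2 * v)))) *
        ENNReal.ofReal (Real.exp ((α * (a - b) / v) * y)) := by
    intro y
    rw [ENNReal.ofReal_rpow_of_pos (Real.exp_pos _), ← Real.exp_mul,
      ← ENNReal.ofReal_mul (Real.exp_nonneg _), ← Real.exp_add]
    congr 2
    ring
  have hmgf : ∫ y, Real.exp ((α * (a - b) / v) * y) ∂(gaussianReal b v) = _ :=
    congrFun (mgf_fun_id_gaussianReal (μ := b) (v := v)) (α * (a - b) / v)
  simp_rw [e]
  rw [lintegral_const_mul _ (by fun_prop), ← ofReal_integral_eq_lintegral_ofReal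
    (integrable_exp_mul_gaussianReal _) (.of_forall fun y => Real.exp_nonneg _), hmgf,
    ← ENNReal.ofReal_mul (Real.exp_nonneg _), ← Real.exp_add]
  congr 2
  field_simp
  ring

lemma gaussianNoise_map_add (m : ℕ) (σ : ℝ) (a : EuclideanSpace ℝ (Fin m)) :
    (gaussianNoise m σ).map (fun z => a + z) =
      (Measure.pi fun i => gaussianReal (a i) (Real.toNNReal (σ ^ 2))).map (WithLp.toLp 2) := by
  have h : (Measure.pi fun i => gaussianReal (a i) (Real.toNNReal (σ ^ 2))) =
      (Measure.pi fun _ : Fin m => gaussianReal 0 (Real.toNNReal (σ ^ 2))).map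
        (fun z i => a i + z i) := by
    rw [Measure.pi_map_pi (f := fun i x => a i + x) (fun i => by fun_prop)]
    simp [gaussianReal_map_const_add]
  rw [h, gaussianNoise, Measure.map_map (by fun_prop) (by fun_prop),
    Measure.map_map (by fun_prop) (by fun_prop)]
  rfl

lemma holderDom_gaussianNoise {α σ : ℝ} (hα : 1 < α) (hσ : 0 < σ) {m : ℕ}
    (a b : EuclideanSpace ℝ (Fin m)) :
    HolderDom (α / (α - 1)) (α * ‖a - b‖ ^ 2 / (2 * σ ^ 2))
      ((gaussianNoise m σ).map (fun z => a + z)) ((gaussianNoise m σ).map (fun z => b + z)) := by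
  have hv : Real.toNNReal (σ ^ 2) ≠ 0 := by
    simpa using hσ.ne'
  have hβ : 0 < α / (α - 1) := div_pos (by linarith) (by linarith)
  rw [gaussianNoise_map_add, gaussianNoise_map_add]
  have h := (HolderDom.pi hβ fun i => holderDom_gaussianReal hα (a i) (b i) hv).map
    (f := WithLp.toLp 2) (by fun_prop)
  convert h using 1
  rw [EuclideanSpace.norm_sq_eq, Real.coe_toNNReal _ (by positivity), Finset.mul_sum,
    Finset.sum_div]
  simp

end Gaussian

/-! ### Hops along two graphs -/

lemma hop_apply {m n : ℕ} (σ : ℝ) (A : Matrix (Fin n) (Fin n) Bool) (X : Fin n → NVec m) :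
    hop m σ A X = Measure.pi fun v =>
      ((gaussianNoise m σ).map (fun z => aggregate A X v + z)).map normalize := by
  have hmap : ∀ v : Fin n, ((gaussianNoise m σ).map (fun z => aggregate A X v + z)).map normalize =
      (gaussianNoise m σ).map (fun z => normalize (aggregate A X v + z)) := fun v =>
    Measure.map_map measurable_normalize (by fun_prop)
  have hmeas : ∀ v : Fin n, Measurable (fun z => normalize (aggregate A X v + z)) := fun v =>
    measurable_normalize.comp (by fun_prop)
  have hprob : ∀ v : Fin n, IsProbabilityMeasure
      ((gaussianNoise m σ).map (fun z => normalize (aggregate A X v + z))) := fun v =>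
    Measure.isProbabilityMeasure_map (hmeas v).aemeasurable
  simp_rw [hmap]
  rw [← Measure.pi_map_pi (f := fun v z => normalize (aggregate A X v + z))
    (fun v => (hmeas v).aemeasurable), hop, Kernel.map_apply _ (measurable_perturb A),
    Kernel.prod_apply, Kernel.id_apply, Kernel.const_apply, Measure.dirac_prod,
    Measure.map_map (measurable_perturb A) (by fun_prop)]
  rfl

instance instProbPerturb {m : ℕ} (σ : ℝ) (a : EuclideanSpace ℝ (Fin m)) :
    IsProbabilityMeasure (((gaussianNoise m σ).map (fun z => a + z)).map normalize) := by
  have : IsProbabilityMeasure ((gaussianNoise m σ).map (fun z => a + z)) :=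
    Measure.isProbabilityMeasure_map (by fun_prop)
  exact Measure.isProbabilityMeasure_map measurable_normalize.aemeasurable

/-- Two hops along graphs whose aggregations differ by at most `√D` in Euclidean norm. -/
lemma holderDom_hop {α σ D : ℝ} (hα : 1 < α) (hσ : 0 < σ) {m n : ℕ}
    {A B : Matrix (Fin n) (Fin n) Bool} {X : Fin n → NVec m}
    (h : ∑ v, ‖aggregate A X v - aggregate B X v‖ ^ 2 ≤ D) :
    HolderDom (α / (α - 1)) (D * α / (2 * σ ^ 2)) (hop m σ A X) (hop m σ B X) := by
  have hβ : 0 < α / (α - 1) := div_pos (by linarith) (by linarith)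
  rw [hop_apply, hop_apply]
  refine (HolderDom.pi hβ fun v => (holderDom_gaussianNoise hα hσ (aggregate A X v)
    (aggregate B X v)).map measurable_normalize).mono hβ ?_
  rw [← Finset.sum_div, ← Finset.mul_sum, mul_comm D]
  gcongr

lemma pma_succ_apply {m n : ℕ} (σ : ℝ) (A : Matrix (Fin n) (Fin n) Bool) (K : ℕ)
    (X : Fin n → NVec m) :
    pma m σ A (K + 1) X = (pma m σ A K X ⊗ₘ (hop m σ A).comap
      (fun p : Fin (K + 1) → Fin n → NVec m => p (Fin.last K)) (by fun_prop)).map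
        (fun p => Fin.snoc (α := fun _ => Fin n → NVec m) p.1 p.2) := by
  rw [pma, Kernel.map_apply _ measurable_snoc, Kernel.compProd_apply_eq_compProd_sectR]
  congr 2

lemma holderDom_pma {α σ D : ℝ} (hα : 1 < α) (hσ : 0 < σ) {m n : ℕ}
    {A B : Matrix (Fin n) (Fin n) Bool}
    (h : ∀ X : Fin n → NVec m, ∑ v, ‖aggregate A X v - aggregate B X v‖ ^ 2 ≤ D)
    (K : ℕ) (X : Fin n → NVec m) :
    HolderDom (α / (α - 1)) (D * K * α / (2 * σ ^ 2)) (pma m σ A K X) (pma m σ B K X) := by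
  have hβ : 0 < α / (α - 1) := div_pos (by linarith) (by linarith)
  induction K with
  | zero =>
    intro φ hφ
    simp only [pma, Kernel.deterministic_apply]
    rw [lintegral_dirac' _ hφ, lintegral_dirac' _ (hφ.pow_const _)]
    simp [ENNReal.rpow_rpow_inv hβ.ne', -inv_div]
  | succ K ih =>
    rw [pma_succ_apply, pma_succ_apply]
    have hc := (ih.compProd hβ fun p => holderDom_hop hα hσ (h (p (Fin.last K)))
      : HolderDom _ _ (_ ⊗ₘ (hop m σ A).comap _ (by fun_prop))
        (_ ⊗ₘ (hop m σ B).comap _ (by fun_prop))).map measurable_snoc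
    refine hc.mono hβ (le_of_eq ?_)
    push_cast
    ring

/-! ### Removing a node -/

/-- The graph `A` without the edges from `q` to other nodes; a loop at `q` and the edges into `q`
are kept. -/
def dropOut {n : ℕ} (A : Matrix (Fin n) (Fin n) Bool) (q : Fin n) : Matrix (Fin n) (Fin n) Bool :=
  fun u v => if u = q ∧ v ≠ q then false else A u v

/-- One row for each node: dropping the row of `q`. -/
def dropRow {n : ℕ} {F : Type*} (q : Fin (n + 1)) (X : Fin (n + 1) → F) : Fin n → F :=
  fun v => X (q.succAbove v)

lemma measurable_dropRow {n : ℕ} {F : Type*} [MeasurableSpace F] (q : Fin (n + 1)) :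
    Measurable (dropRow (F := F) q) := by
  unfold dropRow
  fun_prop

lemma measurable_dropRow_path {m n K : ℕ} (q : Fin (n + 1)) :
    Measurable (fun (p : Fin K → Fin (n + 1) → NVec m) k => dropRow q (p k)) :=
  measurable_pi_lambda _ fun k => (measurable_dropRow q).comp (measurable_pi_apply k)

/-- Since normalized features have norm at most `1`, the aggregated features change by a vector of
norm at most `1` at each of the out-neighbors of `q`, and not at all elsewhere. -/
lemma sum_norm_aggregate_sub_dropOut_le {m n D : ℕ} (A : Matrix (Fin n) (Fin n) Bool) (q : Fin n)
    (hD : (Finset.univ.filter (fun v => A q v = true)).card ≤ D) (X : Fin n → NVec m) :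
    ∑ v, ‖aggregate A X v - aggregate (dropOut A q) X v‖ ^ 2 ≤ (D : ℝ) := by
  have hX : ‖(X q : EuclideanSpace ℝ (Fin m))‖ ≤ 1 := by
    rcases (X q).2 with h | h <;> simp [h]
  have hv : ∀ v, ‖aggregate A X v - aggregate (dropOut A q) X v‖ ^ 2 ≤
      if A q v = true then (1 : ℝ) else 0 := by
    intro v
    have e : aggregate A X v - aggregate (dropOut A q) X v =
        if A q v = true ∧ v ≠ q then (X q : EuclideanSpace ℝ (Fin m)) else 0 := by
      simp only [aggregate]
      rw [← Finset.sum_sub_distrib, Finset.sum_eq_single q]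
      · by_cases h1 : v = q <;> by_cases h2 : A q v = true <;> simp_all [dropOut]
      · intro u _ hu
        simp [dropOut, hu]
      · simp
    rw [e]
    split_ifs with h1 h2 h2
    · exact pow_le_one₀ (norm_nonneg _) hX
    · exact absurd h1.1 h2
    · simp
    · simp
  calc _ ≤ ∑ v, if A q v = true then (1 : ℝ) else 0 := Finset.sum_le_sum fun v _ => hv v
    _ = ((Finset.univ.filter (fun v => A q v = true)).card : ℝ) := by simp
    _ ≤ D := by exact_mod_cast hD

lemma aggregate_dropOut {m n : ℕ} (A : Matrix (Fin (n + 1)) (Fin (n + 1)) Bool) (q : Fin (n + 1))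
    (X : Fin (n + 1) → NVec m) (v : Fin n) :
    aggregate (dropOut A q) X (q.succAbove v) =
      aggregate (A.submatrix q.succAbove q.succAbove) (dropRow q X) v := by
  simp only [aggregate, Fin.sum_univ_succAbove _ q]
  simp only [dropOut, dropRow, Fin.succAbove_ne, ne_eq, not_false_eq_true, and_self, false_and,
    if_true, if_false, Bool.false_eq_true, zero_smul, zero_add]
  rfl

lemma hop_dropOut_map {m n : ℕ} (σ : ℝ) (A : Matrix (Fin (n + 1)) (Fin (n + 1)) Bool)
    (q : Fin (n + 1)) (X : Fin (n + 1) → NVec m) :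
    (hop m σ (dropOut A q) X).map (dropRow q) =
      hop m σ (A.submatrix q.succAbove q.succAbove) (dropRow q X) := by
  rw [hop_apply, hop_apply]
  simp_rw [← aggregate_dropOut]
  set μ : Fin (n + 1) → Measure (NVec m) := fun v =>
    ((gaussianNoise m σ).map (fun z => aggregate (dropOut A q) X v + z)).map normalize
  have h := congrArg (Measure.map Prod.snd) (measurePreserving_piFinSuccAbove μ q).map_eq
  rw [Measure.map_map measurable_snd (MeasurableEquiv.measurable _), ← Measure.snd,
    Measure.snd_prod] at h
  exact h

lemma pma_dropOut_map {m n : ℕ} (σ : ℝ) (A : Matrix (Fin (n + 1)) (Fin (n + 1)) Bool)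
    (q : Fin (n + 1)) (K : ℕ) (X : Fin (n + 1) → NVec m) :
    (pma m σ (dropOut A q) K X).map (fun p k => dropRow q (p k)) =
      pma m σ (A.submatrix q.succAbove q.succAbove) K (dropRow q X) := by
  induction K with
  | zero =>
    simp only [pma, Kernel.deterministic_apply]
    rw [Measure.map_dirac' (measurable_dropRow_path q)]
  | succ K ih =>
    rw [pma_succ_apply, pma_succ_apply, ← ih]
    refine Measure.ext_of_lintegral _ fun φ hφ => ?_
    have hs : Measurable fun p : (Fin (K + 1) → Fin n → NVec m) × (Fin n → NVec m) =>
        φ (Fin.snoc (α := fun _ => Fin n → NVec m) p.1 p.2) := hφ.comp measurable_snoc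
    have hφd : Measurable fun p : Fin (K + 2) → Fin (n + 1) → NVec m =>
        φ fun k => dropRow q (p k) := hφ.comp (measurable_dropRow_path q)
    have hφs : Measurable fun p : (Fin (K + 1) → Fin (n + 1) → NVec m) × (Fin (n + 1) → NVec m) =>
        φ fun k => dropRow q (Fin.snoc (α := fun _ => Fin (n + 1) → NVec m) p.1 p.2 k) :=
      hφd.comp measurable_snoc
    rw [lintegral_map hφ (measurable_dropRow_path q), lintegral_map hφd measurable_snoc,
      lintegral_map hφ measurable_snoc,
      Measure.lintegral_compProd hφs,
      Measure.lintegral_compProd hs, lintegral_map ?_ (measurable_dropRow_path q)]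
    · refine lintegral_congr fun p => ?_
      simp only [Kernel.comap_apply]
      rw [← hop_dropOut_map, lintegral_map (by fun_prop) (measurable_dropRow q)]
      refine lintegral_congr fun y => ?_
      congr 1
      ext k : 1
      refine Fin.lastCases ?_ (fun j => ?_) k <;> simp
    · exact hs.lintegral_kernel_prod_right'

/-! ### Training on adjacent datasets -/

lemma TableAdj.symm {F : Type*} {C : ℕ} {T T' : NodeTable F C} (h : TableAdj T T') :
    TableAdj T' T := by
  obtain ⟨n, X, Y, q, h⟩ := h
  exact ⟨n, X, Y, q, h.symm.imp And.symm And.symm⟩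

lemma tableAdj_removeRow {F : Type*} {C n : ℕ} (X : Fin (n + 1) → F) (Y : Fin (n + 1) → Label C)
    (q : Fin (n + 1)) :
    TableAdj (⟨n + 1, X, Y⟩ : NodeTable F C) ⟨n, dropRow q X, dropRow q Y⟩ :=
  ⟨n, X, Y, q, Or.inl ⟨rfl, rfl⟩⟩

section Training

variable {d C m K D n : ℕ} {Θenc Θcm : Type*} [MeasurableSpace Θenc] [MeasurableSpace Θcm]

/-- Training the classification module on the graph with `q` removed has the same law as running the
aggregation on all `n + 1` nodes without the edges from `q` to other nodes, and dropping the row of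
`q` only when the classification module is trained. -/
lemma bind_pma_removeNode (trainCM : Kernel (NodeTable (Fin (K + 1) → NVec m) C) Θcm) (σ : ℝ)
    (H : GraphData d C (n + 1)) (q : Fin (n + 1)) (X : Fin (n + 1) → NVec m) :
    (pma m σ (H.removeNode q).A K (dropRow q X)).bind
        (trainCM.comap (hopTable (H.removeNode q).Y) (measurable_hopTable _)) =
      (pma m σ (dropOut H.A q) K X).bind
        (trainCM.comap (fun p => hopTable (H.removeNode q).Y fun k => dropRow q (p k))
          ((measurable_hopTable _).comp (measurable_dropRow_path q))) := by
  rw [show (H.removeNode q).A = H.A.submatrix q.succAbove q.succAbove from rfl, ← pma_dropOut_map]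
  refine Measure.ext_of_lintegral _ fun φ hφ => ?_
  rw [Measure.lintegral_bind (Kernel.aemeasurable _) hφ.aemeasurable,
    Measure.lintegral_bind (Kernel.aemeasurable _) hφ.aemeasurable,
    lintegral_map hφ.lintegral_kernel (measurable_dropRow_path q)]
  rfl

/-- Aggregation followed by the training of the classification module, before and after removing a
node, in both directions: aggregation along `H.A` is compared with aggregation along `dropOut H.A q`
on the same `n + 1` nodes, and the tables handed to the training then differ by one row. -/
lemma holderDom_pma_bind {α ε₅ σ : ℝ} (hα : 1 < α) (hσ : 0 < σ)
    (trainCM : Kernel (NodeTable (Fin (K + 1) → NVec m) C) Θcm) [IsMarkovKernel trainCM]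
    (hCM : IsRDP TableAdj (fun T => trainCM T) α ε₅) (H : GraphData d C (n + 1)) (q : Fin (n + 1))
    (hD : DegreeBounded D (⟨n + 1, H⟩ : GraphDataset d C)) (X : Fin (n + 1) → NVec m) :
    HolderDom (α / (α - 1)) (D * K * α / (2 * σ ^ 2) + ε₅)
        ((pma m σ H.A K X).bind (trainCM.comap (hopTable H.Y) (measurable_hopTable _)))
        ((pma m σ (H.removeNode q).A K (dropRow q X)).bind
          (trainCM.comap (hopTable (H.removeNode q).Y) (measurable_hopTable _))) ∧
      HolderDom (α / (α - 1)) (D * K * α / (2 * σ ^ 2) + ε₅)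
        ((pma m σ (H.removeNode q).A K (dropRow q X)).bind
          (trainCM.comap (hopTable (H.removeNode q).Y) (measurable_hopTable _)))
        ((pma m σ H.A K X).bind (trainCM.comap (hopTable H.Y) (measurable_hopTable _))) := by
  have hβ : 0 < α / (α - 1) := div_pos (by linarith) (by linarith)
  have hagg := fun X : Fin (n + 1) → NVec m => sum_norm_aggregate_sub_dropOut_le H.A q (hD q) X
  have hadj : ∀ p : Fin (K + 1) → Fin (n + 1) → NVec m,
      TableAdj (hopTable H.Y p) (hopTable (H.removeNode q).Y fun k => dropRow q (p k)) := fun p =>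
    tableAdj_removeRow (fun v k => p k v) H.Y q
  rw [bind_pma_removeNode]
  constructor
  · exact (holderDom_pma hα hσ hagg K X).bind hβ fun p =>
      HolderDom.of_renyiDiv hα (hCM _ _ (hadj p))
  · refine (holderDom_pma hα hσ (fun X => ?_) K X).bind hβ fun p =>
      HolderDom.of_renyiDiv hα (hCM _ _ (hadj p).symm)
    simp_rw [norm_sub_rev (aggregate (dropOut H.A q) X _)]
    exact hagg X

lemma holderDom_gapTraining {α ε₁ ε₅ σ : ℝ} (hα : 1 < α) (hσ : 0 < σ)
    (enc : Θenc → EuclideanSpace ℝ (Fin d) → EuclideanSpace ℝ (Fin m))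
    (henc : ∀ x, Measurable fun θ => enc θ x)
    (trainEnc : NodeTable (EuclideanSpace ℝ (Fin d)) C → Measure Θenc)
    [∀ T, IsProbabilityMeasure (trainEnc T)]
    (trainCM : Kernel (NodeTable (Fin (K + 1) → NVec m) C) Θcm) [IsMarkovKernel trainCM]
    (hEnc : IsRDP TableAdj trainEnc α ε₁) (hCM : IsRDP TableAdj (fun T => trainCM T) α ε₅)
    {G G' : GraphDataset d C} (h : BoundedNodeAdj D G G') :
    HolderDom (α / (α - 1)) (ε₁ + (D * K * α / (2 * σ ^ 2) + ε₅))
      (gapTraining enc henc trainEnc trainCM σ G) (gapTraining enc henc trainEnc trainCM σ G') := by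
  have hβ : 0 < α / (α - 1) := div_pos (by linarith) (by linarith)
  obtain ⟨⟨n, H, q, ⟨rfl, rfl⟩ | ⟨rfl, rfl⟩⟩, hG, hG'⟩ := h
  · refine HolderDom.compProd hβ (HolderDom.of_renyiDiv hα (hEnc _ _ ?_)) fun θ => ?_
    · exact tableAdj_removeRow H.X H.Y q
    · simp only [Kernel.comp_apply, Kernel.comap_apply]
      exact (holderDom_pma_bind hα hσ trainCM hCM H q hG (encodeNormalize enc H.X θ)).1
  · refine HolderDom.compProd hβ (HolderDom.of_renyiDiv hα (hEnc _ _ ?_)) fun θ => ?_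
    · exact (tableAdj_removeRow H.X H.Y q).symm
    · simp only [Kernel.comp_apply, Kernel.comap_apply]
      exact (holderDom_pma_bind hα hσ trainCM hCM H q hG' (encodeNormalize enc H.X θ)).2

end Training

end GAP

theorem proposition4
    {d C m K D : ℕ} {Θenc Θcm : Type*}
    [MeasurableSpace Θenc] [StandardBorelSpace Θenc]
    [MeasurableSpace Θcm] [StandardBorelSpace Θcm]
    (enc : Θenc → EuclideanSpace ℝ (Fin d) → EuclideanSpace ℝ (Fin m))
    (henc : ∀ x, Measurable fun θ => enc θ x)
    (trainEnc : GAP.NodeTable (EuclideanSpace ℝ (Fin d)) C → Measure Θenc)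
    [∀ T, IsProbabilityMeasure (trainEnc T)]
    (trainCM : Kernel (GAP.NodeTable (Fin (K + 1) → GAP.NVec m) C) Θcm)
    [IsMarkovKernel trainCM]
    (ε₁ ε₅ : ℝ → ℝ) (α : ℝ) (hα : 1 < α)
    (hEnc : GAP.IsRDP GAP.TableAdj trainEnc α (ε₁ α))
    (hCM : GAP.IsRDP GAP.TableAdj (fun T => trainCM T) α (ε₅ α))
    (δ : ℝ) (hδ₀ : 0 < δ) (hδ₁ : δ < 1) (hK : 1 ≤ K) (hD : 1 ≤ D) (σ : ℝ) (hσ : 0 < σ) :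
    GAP.IsDP (GAP.BoundedNodeAdj D) (GAP.gapTraining enc henc trainEnc trainCM σ)
      (ε₁ α + ε₅ α + (D : ℝ) * K * α / (2 * σ ^ 2) + Real.log (1 / δ) / (α - 1)) δ := by
  intro G G' hadj S hS
  rw [add_assoc (ε₁ α), add_comm (ε₅ α)]
  exact (GAP.holderDom_gapTraining hα hσ enc henc trainEnc trainCM hEnc hCM
    hadj).apply_le hα hδ₀ hS
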